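/- For $0\le\lambda\le1$ and $0\le k<1$ let $$F(\lambda,k)=\int_0^\lambda\frac{dt}{\sqrt{(1-t^2)(1-k^2t^2)}},\qquad K(k)=F(1,k),$$ let $(a)_n=a(a+1)\cdots(a+n-1)$, $(a)_0=1$, and for $n\ge0$ and $x>0$ let $$A_n(x)=\frac1{n!}\frac{d^n}{dx^n}\left[\frac{(-1)^n(1/2)_n}{n!\sqrt x}\ln\bigl(\sqrt{1+x}+\sqrt x\bigr)+\frac{\sqrt{1+x}}{2nx}\sum_{j=0}^{n-1}(-1)^j\frac{(1/2-n)_j}{(1-n)_j}x^{n-j}\right],$$ where the second term in brackets is zero for $n=0$. Then, for $0<x<1$, $$A_n(x)=\sum_{j=0}^\infty\binom{n+j}{j}\frac{(-1)^j(1/2)_j}{(2(n+j)+1)\,j!}x^j .$$ Moreover, for $\lambda\in[0,1]$, $k\in(0,1)$ and every integer $N\ge1$, $$F(\lambda,k)=K(k)-\frac{(1-\lambda^2)^{1/2}}{(1-k^2)^{1/2}}\sum_{n=0}^{N-1}(1-\lambda^2)^nA_n\!\left(\frac{1-\lambda^2}{1-k^2}\right)+\tilde R_N(\lambda,k)$$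 (the subtracted term is read as $0$ for $\lambda=1$), where $\tilde R_N(1,k)=0$, and for $0\le\lambda<1$ the remainder is negative and satisfies $$-\tilde R_N(\lambda,k)\ge\frac{(1-\lambda^2)^{N-1/2}(1/2)_N}{2N\,N!}\left(\sqrt{2-\lambda^2-k^2}-\frac{1-k^2}{2\sqrt{1-\lambda^2}}\ln\left\{1+2\frac{1-\lambda^2}{1-k^2}+2\frac{\sqrt{(1-\lambda^2)(2-\lambda^2-k^2)}}{1-k^2}\right\}\right),$$ and for $0<\lambda<1$ also $$-\tilde R_N(\lambda,k)\le\frac{(1-\lambda^2)^{N+1/2}}{2\lambda^2N\sqrt{2-\lambda^2-k^2}} .$$ Consequently the expansion is asymptotic as $\lambda\to1$ along any curve lying inside the open unit square (including curves ending at $(1,1)$): writing $T_n(\lambda,k)=\frac{(1-\lambda^2)^{1/2}}{(1-k^2)^{1/2}}(1-\lambda^2)^nA_n\bigl(\frac{1-\lambda^2}{1-k^2}\bigr)$, along any such curve one has $T_{n+1}=o(T_n)$ for all $n\ge0$ and $\tilde R_N=o(T_{N-1})$ for all $N\ge1$. -/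

import Mathlib

open Filter Topology Asymptotics

noncomputable section

/-- Legendre's incomplete elliptic integral of the first kind,
`F(lam, k) = ∫_0^lam dt / √((1 - t²)(1 - k² t²))`. -/
def ellipticF (lam k : ℝ) : ℝ :=
  ∫ t in (0 : ℝ)..lam, 1 / Real.sqrt ((1 - t ^ 2) * (1 - k ^ 2 * t ^ 2))

/-- The complete elliptic integral of the first kind, `K(k) = F(1, k)` (finite for `0 ≤ k < 1`). -/
def ellipticK (k : ℝ) : ℝ := ellipticF 1 k

/-- The Pochhammer symbol `(a)_n = a (a + 1) ⋯ (a + n - 1)`. -/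
def poch (a : ℝ) (n : ℕ) : ℝ := ∏ i ∈ Finset.range n, (a + i)

/-- The elementary function whose `n`-th derivative, divided by `n!`, is `A_n`:
`(-1)^n (1/2)_n / (n! √x) ln(√(1+x) + √x)
  + √(1+x) / (2 n x) ∑_{j<n} (-1)^j (1/2-n)_j / (1-n)_j x^{n-j}`.
The second term vanishes for `n = 0`, since the sum is then empty. -/
def preA (n : ℕ) (x : ℝ) : ℝ :=
  (-1) ^ n * poch (1 / 2) n / (n.factorial * Real.sqrt x)
      * Real.log (Real.sqrt (1 + x) + Real.sqrt x)
    + Real.sqrt (1 + x) / (2 * n * x)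
      * ∑ j ∈ Finset.range n,
          (-1) ^ j * (poch (1 / 2 - n) j / poch (1 - n) j) * x ^ (n - j)

/-- The elementary functions `A_n(x) = (1/n!) D_x^n [preA n x]`, for `x > 0`. -/
def coeffA (n : ℕ) (x : ℝ) : ℝ := iteratedDeriv n (preA n) x / n.factorial

/-- The `n`-th term of the expansion,
`√((1-lam²)/(1-k²)) (1-lam²)^n A_n((1-lam²)/(1-k²))`. -/
def expansionTerm (n : ℕ) (lam k : ℝ) : ℝ :=
  Real.sqrt (1 - lam ^ 2) / Real.sqrt (1 - k ^ 2)
    * ((1 - lam ^ 2) ^ n * coeffA n ((1 - lam ^ 2) / (1 - k ^ 2)))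

/-- The upper bound for the negated remainder (meaningful for `lam ≠ 0`). -/
def upperBound (N : ℕ) (lam k : ℝ) : ℝ :=
  (1 - lam ^ 2) ^ ((N : ℝ) + 1 / 2) / (2 * lam ^ 2 * N * Real.sqrt (2 - lam ^ 2 - k ^ 2))

/-- The lower bound for the negated remainder. -/
def lowerBound (N : ℕ) (lam k : ℝ) : ℝ :=
  (1 - lam ^ 2) ^ ((N : ℝ) - 1 / 2) * poch (1 / 2) N / (2 * N * N.factorial)
    * (Real.sqrt (2 - lam ^ 2 - k ^ 2)
        - (1 - k ^ 2) / (2 * Real.sqrt (1 - lam ^ 2))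
          * Real.log (1 + 2 * ((1 - lam ^ 2) / (1 - k ^ 2))
              + 2 * (Real.sqrt ((1 - lam ^ 2) * (2 - lam ^ 2 - k ^ 2)) / (1 - k ^ 2))))

end

/-! Put s = 1 - lam² and x = s / (1 - k²). The substitution t = √(1 - s u²) turns K - F into √s /
√(1 - k²) times the integral over 0 < u < 1 of (1 - w)^(-1/2) (1 - w + y)^(-1/2), with w = s u² and
y = x u² (`ellipticK_sub_ellipticF`). With y held fixed, this kernel is a power series in w with
positive coefficients `kernelCoeff n y`, and integrating its n-th term gives s^n A_n(x).

That last identity is `coeffA_eq_integral`: the bracket defining A_n is the integral of (x u²)^n (1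
+ x u²)^(-1/2), by a recurrence from integration by parts, and the n-th derivative of y^n (1 +
y)^(-1/2) is n! `kernelCoeff n y`.

The negated remainder is therefore the integrated tail of a positive series. It is at least its
first omitted term, which gives its sign and the lower bound. Since `kernelCoeff n y` lies between
(1/2)_n / n! times (1 + y)^(-1/2) and (1 + y)^(-1/2), a geometric series bounds the tail from above,
and all estimates reduce to the moments `sqrtMoment`. The resulting bounds have the common shape
`termScale`, which gains a factor 1 - lam² at each order whatever k does; this makes the expansion
asymptotic even towards (1, 1). -/

/-! ### Pochhammer symbols and binomial series -/

/-- The coefficient `(a)_n / n!` of `z ^ n` in `(1 - z) ^ (-a)`. -/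
noncomputable def pochCoeff (a : ℝ) (n : ℕ) : ℝ := poch a n / n.factorial

theorem poch_succ (a : ℝ) (n : ℕ) : poch a (n + 1) = poch a n * (a + n) :=
  Finset.prod_range_succ _ _

theorem poch_add (a : ℝ) (m n : ℕ) : poch a (m + n) = poch a m * poch (a + m) n := by
  simp only [poch, Finset.prod_range_add]
  congr 1
  exact Finset.prod_congr rfl fun i _ => by push_cast; ring

theorem poch_eq_ascPochhammer (a : ℝ) (n : ℕ) : poch a n = (ascPochhammer ℝ n).eval a := by
  induction n with
  | zero => simp [poch]
  | succ n ih => rw [poch_succ, ascPochhammer_succ_eval, ih]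

theorem pochCoeff_eq_multichoose (a : ℝ) (n : ℕ) : pochCoeff a n = Ring.multichoose a n := by
  have h := Ring.factorial_nsmul_multichoose_eq_ascPochhammer a n
  rw [Polynomial.ascPochhammer_smeval_eq_eval, ← poch_eq_ascPochhammer, nsmul_eq_mul] at h
  rw [pochCoeff, ← h]
  field_simp

theorem choose_neg_eq_pochCoeff (a : ℝ) (n : ℕ) :
    Ring.choose (-a) n = (-1) ^ n * pochCoeff a n := by
  rw [Ring.choose_neg, pochCoeff_eq_multichoose, Ring.multichoose_eq]
  rcases Nat.even_or_odd n with h | h <;> simp [h, Units.smul_def, Int.negOnePow_even, Int.negOnePow_odd]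

/-- Chu–Vandermonde for binomial coefficients with upper arguments -a and -b; the signs (-1)^p
(-1)^(n-p) combine to a common (-1)^n, which cancels. -/
theorem sum_pochCoeff_mul_pochCoeff (a b : ℝ) (n : ℕ) :
    ∑ p ∈ Finset.range (n + 1), pochCoeff a p * pochCoeff b (n - p) = pochCoeff (a + b) n := by
  have h := Ring.add_choose_eq (r := -a) (s := -b) n (Commute.all _ _)
  rw [← neg_add, choose_neg_eq_pochCoeff, Finset.Nat.sum_antidiagonal_eq_sum_range_succ_mk] at h
  have h1 : ((-1 : ℝ) ^ n) ≠ 0 := by positivity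
  refine mul_left_cancel₀ h1 ?_
  rw [h, Finset.mul_sum]
  refine Finset.sum_congr rfl fun p hp => ?_
  have hp' : p + (n - p) = n := by have := Finset.mem_range.1 hp; omega
  simp only [choose_neg_eq_pochCoeff]
  conv_lhs => rw [← hp', pow_add, Nat.add_sub_cancel_left]
  ring

theorem hasSum_pochCoeff_mul_pow (a : ℝ) {z : ℝ} (hz : |z| < 1) :
    HasSum (fun j => pochCoeff a j * z ^ j) ((1 - z) ^ (-a)) := by
  have h := (Real.one_div_one_sub_rpow_hasFPowerSeriesOnBall_zero a).hasSum (y := z)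
    (by simpa [enorm_eq_nnnorm] using! hz)
  have hz' : 0 ≤ 1 - z := by linarith [(abs_lt.1 hz).2]
  rw [zero_add, one_div, ← Real.rpow_neg hz'] at h
  refine h.congr_fun ?_
  intro j
  simp [pochCoeff_eq_multichoose, Ring.multichoose_eq, mul_comm]

theorem poch_pos {a : ℝ} (ha : 0 < a) (n : ℕ) : 0 < poch a n :=
  Finset.prod_pos fun i _ => by positivity

theorem pochCoeff_pos {a : ℝ} (ha : 0 < a) (n : ℕ) : 0 < pochCoeff a n :=
  div_pos (poch_pos ha n) (by positivity)

theorem pochCoeff_one (n : ℕ) : pochCoeff 1 n = 1 := by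
  have : poch 1 n = n.factorial := by
    rw [poch_eq_ascPochhammer, ascPochhammer_eval_one]
  rw [pochCoeff, this, div_self (by positivity)]

theorem pochCoeff_zero (a : ℝ) : pochCoeff a 0 = 1 := by simp [pochCoeff, poch]

theorem pochCoeff_add_one (j n : ℕ) : pochCoeff (1 + j) n = (n + j).choose j := by
  rw [Nat.add_choose, Nat.cast_div (Nat.factorial_mul_factorial_dvd_factorial_add _ _) (by positivity)]
  have h := poch_add 1 j n
  have h1 : ∀ i : ℕ, poch 1 i = i.factorial := fun i => by
    rw [poch_eq_ascPochhammer, ascPochhammer_eval_one]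
  rw [h1, h1] at h
  rw [pochCoeff, add_comm n j, h]
  push_cast
  field_simp

/-! ### Coefficients of the kernel: generating function, bounds, Taylor series -/

/-- The coefficient of `w ^ n` in `(1 - w) ^ (-1/2) * (1 - w + y) ^ (-1/2)`. -/
noncomputable def kernelCoeff (n : ℕ) (y : ℝ) : ℝ :=
  ∑ p ∈ Finset.range (n + 1),
    pochCoeff (1 / 2) p * pochCoeff (1 / 2) (n - p) * (1 + y) ^ (-(1 / 2 + p : ℝ))

/-- Since 1 - w + y = (1 + y)(1 - w / (1 + y)), this is the Cauchy product of two binomial series,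
in w / (1 + y) and in w. -/
theorem hasSum_kernelCoeff_mul_pow {w y : ℝ} (hw : 0 ≤ w) (hw1 : w < 1) (hy : 0 ≤ y) :
    HasSum (fun n => kernelCoeff n y * w ^ n)
      ((1 - w) ^ (-(1 / 2) : ℝ) * (1 - w + y) ^ (-(1 / 2) : ℝ)) := by
  have hy1 : 0 < 1 + y := by linarith
  have hz1 : w / (1 + y) < 1 := by rw [div_lt_one hy1]; linarith
  have hz0 : 0 ≤ w / (1 + y) := by positivity
  have h1 := hasSum_pochCoeff_mul_pow (1 / 2) (z := w) (by rwa [abs_of_nonneg hw])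
  have h2 := (hasSum_pochCoeff_mul_pow (1 / 2) (z := w / (1 + y))
    (by rwa [abs_of_nonneg hz0])).mul_left ((1 + y) ^ (-(1 / 2) : ℝ))
  rw [← Real.mul_rpow hy1.le (by linarith),
    show (1 + y) * (1 - w / (1 + y)) = 1 - w + y by field_simp; ring] at h2
  have h := hasSum_sum_range_mul_of_summable_norm h2.summable.norm h1.summable.norm
  rw [h2.tsum_eq, h1.tsum_eq, mul_comm] at h
  refine h.congr_fun ?_
  intro n
  rw [kernelCoeff, Finset.sum_mul]
  refine Finset.sum_congr rfl fun p hp => ?_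
  have hp' : p + (n - p) = n := by have := Finset.mem_range.1 hp; omega
  rw [neg_add, Real.rpow_add hy1, Real.rpow_neg hy1.le (p : ℝ), Real.rpow_natCast]
  conv_lhs => rw [← hp', pow_add, Nat.add_sub_cancel_left]
  rw [div_pow]
  field_simp

/-- The weights sum to (1)_n / n! = 1 because 1/2 + 1/2 = 1, and each extra factor (1 + y)^(-p) is
at most 1. -/
theorem kernelCoeff_le {n : ℕ} {y : ℝ} (hy : 0 ≤ y) :
    kernelCoeff n y ≤ (1 + y) ^ (-(1 / 2) : ℝ) := by
  have h : ∑ p ∈ Finset.range (n + 1), pochCoeff (1 / 2) p * pochCoeff (1 / 2) (n - p) = 1 := by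
    rw [sum_pochCoeff_mul_pochCoeff]; norm_num [pochCoeff_one]
  calc kernelCoeff n y ≤ ∑ p ∈ Finset.range (n + 1),
        pochCoeff (1 / 2) p * pochCoeff (1 / 2) (n - p) * (1 + y) ^ (-(1 / 2) : ℝ) := by
        refine Finset.sum_le_sum fun p _ => mul_le_mul_of_nonneg_left ?_
          (mul_pos (pochCoeff_pos (by norm_num) _) (pochCoeff_pos (by norm_num) _)).le
        refine Real.rpow_le_rpow_of_exponent_le (by linarith) ?_
        have : (0 : ℝ) ≤ p := by positivity
        linarith
    _ = _ := by rw [← Finset.sum_mul, h, one_mul]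

/-- Only the p = 0 summand is kept; the others are nonnegative. -/
theorem le_kernelCoeff {n : ℕ} {y : ℝ} (hy : 0 ≤ y) :
    pochCoeff (1 / 2) n * (1 + y) ^ (-(1 / 2) : ℝ) ≤ kernelCoeff n y := by
  have h := Finset.single_le_sum (s := Finset.range (n + 1)) (a := 0)
    (f := fun p => pochCoeff (1 / 2) p * pochCoeff (1 / 2) (n - p) * (1 + y) ^ (-(1 / 2 + p : ℝ)))
    (fun p _ => mul_nonneg (mul_pos (pochCoeff_pos (by norm_num) _)
      (pochCoeff_pos (by norm_num) _)).le (Real.rpow_nonneg (by linarith) _)) (by simp)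
  unfold kernelCoeff
  simpa [pochCoeff_zero] using h

theorem kernelCoeff_pos {n : ℕ} {y : ℝ} (hy : 0 ≤ y) : 0 < kernelCoeff n y :=
  (mul_pos (pochCoeff_pos (by norm_num) n) (Real.rpow_pos_of_pos (by linarith) _)).trans_le
    (le_kernelCoeff hy)

theorem continuousOn_kernelCoeff (n : ℕ) : ContinuousOn (kernelCoeff n) (Set.Ioi (-1)) := by
  unfold kernelCoeff
  refine continuousOn_finsetSum _ fun p _ => continuousOn_const.mul ?_
  refine ContinuousOn.rpow_const (by fun_prop) fun y hy => Or.inl ?_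
  have : -1 < y := hy
  linarith

/-- Each power (1 + y)^(-1/2 - p) is expanded in y. The identity (1/2)_p (1/2 + p)_j = (1/2)_j (1/2
+ j)_p then makes the sum over p a Vandermonde sum with parameters 1/2 + j and 1/2, whose value is
the binomial coefficient. -/
theorem hasSum_kernelCoeff {n : ℕ} {y : ℝ} (hy : |y| < 1) :
    HasSum (fun j : ℕ => ((n + j).choose j : ℝ) * ((-1) ^ j * pochCoeff (1 / 2) j) * y ^ j)
      (kernelCoeff n y) := by
  have h : ∀ p ∈ Finset.range (n + 1), HasSum (fun j => pochCoeff (1 / 2) p *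
      pochCoeff (1 / 2) (n - p) * (pochCoeff (1 / 2 + p) j * (-y) ^ j))
      (pochCoeff (1 / 2) p * pochCoeff (1 / 2) (n - p) * (1 + y) ^ (-(1 / 2 + p : ℝ))) := by
    intro p _
    have := (hasSum_pochCoeff_mul_pow (1 / 2 + p) (z := -y) (by rwa [abs_neg])).mul_left
      (pochCoeff (1 / 2) p * pochCoeff (1 / 2) (n - p))
    rwa [sub_neg_eq_add] at this
  refine (hasSum_sum h).congr_fun ?_
  intro j
  have h2 : ∀ p, pochCoeff (1 / 2) p * pochCoeff (1 / 2 + p) j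
      = pochCoeff (1 / 2) j * pochCoeff (1 / 2 + j) p := by
    intro p
    have h3 := poch_add (1 / 2) p j
    rw [add_comm p j, poch_add] at h3
    simp only [pochCoeff]
    rw [div_mul_div_comm, div_mul_div_comm, ← h3, mul_comm (p.factorial : ℝ)]
  have h4 := sum_pochCoeff_mul_pochCoeff (1 / 2 + j) (1 / 2) n
  rw [show (1 / 2 + j + 1 / 2 : ℝ) = 1 + j by ring, pochCoeff_add_one] at h4
  rw [← h4, Finset.sum_mul, Finset.sum_mul]
  refine Finset.sum_congr rfl fun p _ => ?_
  rw [neg_pow]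
  linear_combination (-(pochCoeff (1 / 2) (n - p)) * (-1) ^ j * y ^ j) * h2 p

/-! ### Integral representation of A_n -/

theorem poch_succ' (a : ℝ) (n : ℕ) : poch a (n + 1) = a * poch (a + 1) n := by
  rw [add_comm, poch_add]; simp [poch]

theorem preA_zero (x : ℝ) :
    preA 0 x = Real.log (Real.sqrt (1 + x) + Real.sqrt x) / Real.sqrt x := by
  simp [preA, poch]; ring

/-- The j = 0 summand supplies the new algebraic term; shifting j by one in the rest, and raising n
in the logarithmic coefficient, each produce the factor -(2n + 1) / (2n + 2). -/
theorem preA_succ (n : ℕ) {x : ℝ} (hx : 0 < x) :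
    preA (n + 1) x = x ^ n * Real.sqrt (1 + x) / (2 * n + 2)
      - (2 * n + 1) / (2 * n + 2) * preA n x := by
  have hs : 0 < Real.sqrt x := Real.sqrt_pos.2 hx
  have hlog : (-1 : ℝ) ^ (n + 1) * poch (1 / 2) (n + 1) / ((n + 1).factorial * Real.sqrt x)
      = -((2 * n + 1) / (2 * n + 2)) * ((-1) ^ n * poch (1 / 2) n / (n.factorial * Real.sqrt x)) := by
    rw [poch_succ, Nat.factorial_succ, pow_succ]
    push_cast
    field_simp
    ring
  have hsum : Real.sqrt (1 + x) / (2 * (n + 1 : ℕ) * x) * ∑ j ∈ Finset.range (n + 1),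
        (-1) ^ j * (poch (1 / 2 - (n + 1 : ℕ)) j / poch (1 - (n + 1 : ℕ)) j) * x ^ (n + 1 - j)
      = x ^ n * Real.sqrt (1 + x) / (2 * n + 2) - (2 * n + 1) / (2 * n + 2) *
        (Real.sqrt (1 + x) / (2 * n * x) * ∑ j ∈ Finset.range n,
          (-1) ^ j * (poch (1 / 2 - n) j / poch (1 - n) j) * x ^ (n - j)) := by
    rw [Finset.sum_range_succ']
    -- At n = 0 the sum on the right is empty, and the shift ratio (n + 1/2) / n used below has no
    -- meaning.
    rcases Nat.eq_zero_or_pos n with rfl | hn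
    · simp [poch]; field_simp
    have hn' : (0 : ℝ) < n := by exact_mod_cast hn
    have h : ∀ j ∈ Finset.range n, (-1 : ℝ) ^ (j + 1) * (poch (1 / 2 - (n + 1 : ℕ)) (j + 1)
          / poch (1 - (n + 1 : ℕ)) (j + 1)) * x ^ (n + 1 - (j + 1))
        = -((n + 1 / 2) / n) *
          ((-1) ^ j * (poch (1 / 2 - n) j / poch (1 - n) j) * x ^ (n - j)) := by
      intro j _
      rw [poch_succ', poch_succ', Nat.add_sub_add_right, mul_div_mul_comm,
        show (1 / 2 - ((n + 1 : ℕ) : ℝ) + 1) = 1 / 2 - n by push_cast; ring,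
        show (1 - ((n + 1 : ℕ) : ℝ) + 1) = 1 - n by push_cast; ring,
        show (1 / 2 - ((n + 1 : ℕ) : ℝ)) / (1 - ((n + 1 : ℕ) : ℝ)) = (n + 1 / 2) / n by
          push_cast
          rw [show (1 / 2 - ((n : ℝ) + 1)) = -(n + 1 / 2) by ring,
            show (1 - ((n : ℝ) + 1)) = -n by ring, neg_div_neg_eq], pow_succ]
      ring
    rw [Finset.sum_congr rfl h, ← Finset.mul_sum]
    set S := ∑ j ∈ Finset.range n,
      (-1 : ℝ) ^ j * (poch (1 / 2 - n) j / poch (1 - n) j) * x ^ (n - j)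
    simp only [poch, Finset.range_zero, Finset.prod_empty, pow_zero, Nat.sub_zero, pow_succ]
    push_cast
    field_simp
    ring
  unfold preA
  rw [hsum, hlog]
  ring

theorem one_add_mul_sq_pos {x : ℝ} (hx : 0 ≤ x) (u : ℝ) : 0 < 1 + x * u ^ 2 := by positivity

theorem continuous_one_add_mul_sq_rpow {x : ℝ} (hx : 0 ≤ x) (a : ℝ) :
    Continuous fun u : ℝ => (1 + x * u ^ 2) ^ a :=
  Continuous.rpow_const (by fun_prop) fun u => Or.inl (one_add_mul_sq_pos hx u).ne'

theorem rpow_neg_half (x : ℝ) (hx : 0 ≤ x) : x ^ (-(1 / 2) : ℝ) = 1 / Real.sqrt x := by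
  rw [Real.rpow_neg hx, ← Real.sqrt_eq_rpow, one_div]

/-- Integrates the derivative of u^(2n+1) √(1 + x u²) over [0, 1]. -/
theorem integral_pow_mul_rpow_succ (n : ℕ) {x : ℝ} (hx : 0 ≤ x) :
    (2 * n + 1) * (∫ u in (0 : ℝ)..1, u ^ (2 * n) * (1 + x * u ^ 2) ^ (-(1 / 2) : ℝ))
      + (2 * n + 2) * x *
        (∫ u in (0 : ℝ)..1, u ^ (2 * (n + 1)) * (1 + x * u ^ 2) ^ (-(1 / 2) : ℝ))
      = Real.sqrt (1 + x) := by
  have hc := continuous_one_add_mul_sq_rpow hx (-(1 / 2))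
  have hd : ∀ u ∈ Set.uIcc (0 : ℝ) 1, HasDerivAt
      (fun u : ℝ => u ^ (2 * n + 1) * Real.sqrt (1 + x * u ^ 2))
      ((2 * n + 1) * (u ^ (2 * n) * (1 + x * u ^ 2) ^ (-(1 / 2) : ℝ)) + (2 * n + 2) * x *
        (u ^ (2 * (n + 1)) * (1 + x * u ^ 2) ^ (-(1 / 2) : ℝ))) u := by
    intro u _
    have hp := one_add_mul_sq_pos hx u
    have h := (hasDerivAt_pow (2 * n + 1) u).mul
      ((((hasDerivAt_pow 2 u).const_mul x).const_add 1).sqrt hp.ne')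
    convert! h using 1
    rw [rpow_neg_half _ hp.le]
    have hs := Real.sqrt_pos.2 hp
    have hss := Real.sq_sqrt hp.le
    set r := Real.sqrt (1 + x * u ^ 2)
    push_cast
    field_simp
    rw [hss]
    ring
  have h := intervalIntegral.integral_eq_sub_of_hasDerivAt hd
    (Continuous.intervalIntegrable (by fun_prop) _ _)
  rw [intervalIntegral.integral_add (Continuous.intervalIntegrable (by fun_prop) _ _)
    (Continuous.intervalIntegrable (by fun_prop) _ _),
    intervalIntegral.integral_const_mul, intervalIntegral.integral_const_mul] at h
  simpa using h

theorem integral_rpow_neg_half {x : ℝ} (hx : 0 < x) :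
    ∫ u in (0 : ℝ)..1, (1 + x * u ^ 2) ^ (-(1 / 2) : ℝ)
      = Real.log (Real.sqrt (1 + x) + Real.sqrt x) / Real.sqrt x := by
  have hs := Real.sqrt_pos.2 hx
  have hss := Real.sq_sqrt hx.le
  have hd : ∀ u ∈ Set.uIcc (0 : ℝ) 1, HasDerivAt
      (fun u : ℝ => Real.arsinh (Real.sqrt x * u) / Real.sqrt x)
      ((1 + x * u ^ 2) ^ (-(1 / 2) : ℝ)) u := by
    intro u _
    have h := (((hasDerivAt_id u).const_mul (Real.sqrt x)).arsinh).div_const (Real.sqrt x)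
    convert! h using 1
    rw [rpow_neg_half _ (one_add_mul_sq_pos hx.le u).le]
    simp [mul_pow, hss]
    field_simp
  have h := intervalIntegral.integral_eq_sub_of_hasDerivAt hd
    ((continuous_one_add_mul_sq_rpow hx.le _).intervalIntegrable _ _)
  rw [h]
  simp [Real.arsinh, hss, add_comm]

/-- Both sides obey the same first-order recurrence in n, and for n = 0 the integral is an arsinh.
-/
theorem preA_eq_integral (n : ℕ) {x : ℝ} (hx : 0 < x) :
    preA n x = x ^ n * ∫ u in (0 : ℝ)..1, u ^ (2 * n) * (1 + x * u ^ 2) ^ (-(1 / 2) : ℝ) := by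
  induction n with
  | zero =>
    rw [preA_zero, ← integral_rpow_neg_half hx]
    simp
  | succ n ih =>
    rw [preA_succ n hx, ih, ← integral_pow_mul_rpow_succ n hx.le]
    field_simp
    ring

theorem hasDerivAt_integral_pow_mul_comp {φ φ' : ℝ → ℝ}
    (hφ : ∀ y, 0 ≤ y → HasDerivAt φ (φ' y) y) (hφ' : ContinuousOn φ' (Set.Ici 0)) (k : ℕ)
    {x : ℝ} (hx : 0 < x) :
    HasDerivAt (fun x => ∫ u in (0 : ℝ)..1, u ^ (2 * k) * φ (x * u ^ 2))
      (∫ u in (0 : ℝ)..1, u ^ (2 * (k + 1)) * φ' (x * u ^ 2)) x := by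
  have hφc : ContinuousOn φ (Set.Ici 0) := fun y hy =>
    (hφ y hy).continuousAt.continuousWithinAt
  have hcont : ∀ {g : ℝ → ℝ} (j : ℕ), ContinuousOn g (Set.Ici 0) → ∀ z, 0 < z →
      Continuous fun u : ℝ => u ^ (2 * j) * g (z * u ^ 2) := by
    intro g j hg z hz
    refine (continuous_pow _).mul (hg.comp_continuous (by fun_prop) fun u => ?_)
    exact mul_nonneg hz.le (sq_nonneg u)
  -- For parameters z in (0, x + 1) and u in (0, 1] the argument z u² stays in this compact
  -- interval, so a constant dominates the differentiated integrand.
  obtain ⟨C, hC⟩ := (isCompact_Icc (a := (0 : ℝ)) (b := x + 1)).exists_bound_of_continuousOn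
    (hφ'.mono fun y hy => hy.1)
  refine (intervalIntegral.hasDerivAt_integral_of_dominated_loc_of_deriv_le
    (s := Set.Ioo 0 (x + 1)) (bound := fun _ => C)
    (F := fun x u => u ^ (2 * k) * φ (x * u ^ 2))
    (F' := fun x u => u ^ (2 * (k + 1)) * φ' (x * u ^ 2))
    (Ioo_mem_nhds hx (by linarith)) ?_ ((hcont k hφc x hx).intervalIntegrable _ _)
    (hcont (k + 1) hφ' x hx).aestronglyMeasurable ?_ intervalIntegrable_const ?_).2
  · filter_upwards [Ioi_mem_nhds hx] with z hz
    exact (hcont k hφc z hz).aestronglyMeasurable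
  · refine Eventually.of_forall fun u hu z hz => ?_
    rw [Set.uIoc_of_le zero_le_one] at hu
    have hu2 : u ^ 2 ≤ 1 := pow_le_one₀ hu.1.le hu.2
    have hb := hC (z * u ^ 2) ⟨mul_nonneg hz.1.le (sq_nonneg u), by nlinarith [hz.1, hz.2]⟩
    rw [norm_mul, Real.norm_of_nonneg (pow_nonneg hu.1.le _)]
    exact (mul_le_of_le_one_left (norm_nonneg _) (pow_le_one₀ hu.1.le hu.2)).trans hb
  · refine Eventually.of_forall fun u hu z hz => ?_
    have h := ((hφ (z * u ^ 2) (mul_nonneg hz.1.le (sq_nonneg u))).comp z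
      ((hasDerivAt_id z).mul_const (u ^ 2))).const_mul (u ^ (2 * k))
    convert! h using 1
    ring

theorem iteratedDeriv_integral_comp {φ : ℕ → ℝ → ℝ}
    (hφ : ∀ k y, 0 ≤ y → HasDerivAt (φ k) (φ (k + 1) y) y) (k : ℕ) {x : ℝ} (hx : 0 < x) :
    iteratedDeriv k (fun x => ∫ u in (0 : ℝ)..1, φ 0 (x * u ^ 2)) x
      = ∫ u in (0 : ℝ)..1, u ^ (2 * k) * φ k (x * u ^ 2) := by
  induction k generalizing x with
  | zero => simp
  | succ k ih =>
    rw [iteratedDeriv_succ]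
    have h : iteratedDeriv k (fun x => ∫ u in (0 : ℝ)..1, φ 0 (x * u ^ 2)) =ᶠ[𝓝 x]
        fun x => ∫ u in (0 : ℝ)..1, u ^ (2 * k) * φ k (x * u ^ 2) := by
      filter_upwards [Ioi_mem_nhds hx] with z hz using ih hz
    rw [h.deriv_eq]
    exact (hasDerivAt_integral_pow_mul_comp (hφ k) (fun y hy =>
      (hφ (k + 1) y hy).continuousAt.continuousWithinAt) k hx).deriv

/-- The `k`-th derivative of `y ^ n * (1 + y) ^ (-1/2)`, expanded in powers of `1 + y`. -/
noncomputable def kernelDeriv (n k : ℕ) (y : ℝ) : ℝ :=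
  ∑ p ∈ Finset.range (n + 1), (n.choose p * (-1) ^ p *
    ∏ i ∈ Finset.range k, ((n : ℝ) - p - 1 / 2 - i)) * (1 + y) ^ ((n : ℝ) - p - 1 / 2 - k)

/-- Binomial expansion of y^n = ((1 + y) - 1)^n, which leaves pure powers of 1 + y to differentiate.
-/
theorem kernelDeriv_zero (n : ℕ) {y : ℝ} (hy : 0 ≤ y) :
    kernelDeriv n 0 y = y ^ n * (1 + y) ^ (-(1 / 2) : ℝ) := by
  have hy1 : 0 < 1 + y := by linarith
  have h := add_pow (-1 : ℝ) (1 + y) n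
  rw [show (-1 : ℝ) + (1 + y) = y by ring] at h
  rw [h, kernelDeriv, Finset.sum_mul]
  refine Finset.sum_congr rfl fun p hp => ?_
  have hp' : p ≤ n := by have := Finset.mem_range.1 hp; omega
  rw [show (n : ℝ) - p - 1 / 2 - (0 : ℕ) = ((n - p : ℕ) : ℝ) + -(1 / 2) by
    push_cast [hp']; ring, Real.rpow_add hy1, Real.rpow_natCast]
  simp
  ring

theorem hasDerivAt_kernelDeriv (n k : ℕ) {y : ℝ} (hy : 0 ≤ y) :
    HasDerivAt (kernelDeriv n k) (kernelDeriv n (k + 1) y) y := by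
  have hy1 : 0 < 1 + y := by linarith
  refine HasDerivAt.fun_sum fun p _ => ?_
  have h := (((hasDerivAt_id y).const_add 1).rpow_const (p := (n : ℝ) - p - 1 / 2 - k)
    (Or.inl hy1.ne')).const_mul (n.choose p * (-1) ^ p *
      ∏ i ∈ Finset.range k, ((n : ℝ) - p - 1 / 2 - i))
  convert! h using 1
  rw [Finset.prod_range_succ, show (n : ℝ) - p - 1 / 2 - (k + 1 : ℕ)
    = (n : ℝ) - p - 1 / 2 - k - 1 by push_cast; ring]
  simp
  ring

/-- The q positive factors form (1/2)_q and the p negative ones (-1)^p (1/2)_p. -/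
theorem prod_range_sub_half (q p : ℕ) :
    ∏ i ∈ Finset.range (q + p), ((q : ℝ) - 1 / 2 - i)
      = (-1) ^ p * poch (1 / 2) p * poch (1 / 2) q := by
  induction q with
  | zero =>
    simp only [Nat.cast_zero, zero_add, poch, Finset.prod_range_zero, mul_one]
    rw [← Finset.card_range p, ← Finset.prod_const, Finset.card_range, ← Finset.prod_mul_distrib]
    exact Finset.prod_congr rfl fun i _ => by ring
  | succ q ih =>
    rw [add_right_comm, Finset.prod_range_succ', poch_succ]
    push_cast
    rw [Finset.prod_congr rfl fun (i : ℕ) _ =>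
      show ((q : ℝ) + 1 - 1 / 2 - (i + 1)) = q - 1 / 2 - i by ring, ih]
    ring

theorem kernelDeriv_self (n : ℕ) (y : ℝ) :
    kernelDeriv n n y = n.factorial * kernelCoeff n y := by
  rw [kernelDeriv, kernelCoeff, Finset.mul_sum]
  refine Finset.sum_congr rfl fun p hp => ?_
  obtain ⟨q, rfl⟩ := Nat.exists_eq_add_of_le (Nat.lt_succ_iff.1 (Finset.mem_range.1 hp))
  rw [show ((p + q : ℕ) : ℝ) - p - 1 / 2 = q - 1 / 2 by push_cast; ring,
    show (q : ℝ) - 1 / 2 - (p + q : ℕ) = -(1 / 2 + p) by push_cast; ring, add_comm p q,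
    prod_range_sub_half, add_comm q p, Nat.add_sub_cancel_left, pochCoeff, pochCoeff]
  have h : ((p + q).choose p : ℝ) * p.factorial * q.factorial = (p + q).factorial := by
    rw [Nat.choose_symm_add]
    exact_mod_cast Nat.add_choose_mul_factorial_mul_factorial p q
  rw [← h]
  have h1 : (-1 : ℝ) ^ p * (-1) ^ p = 1 := by rw [← mul_pow]; simp
  generalize (1 + y) ^ (-(1 / 2 + p : ℝ)) = z
  field_simp
  linear_combination ((p + q).choose p : ℝ) * poch (1 / 2) p * poch (1 / 2) q * z * h1

theorem coeffA_eq_integral (n : ℕ) {x : ℝ} (hx : 0 < x) :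
    coeffA n x = ∫ u in (0 : ℝ)..1, u ^ (2 * n) * kernelCoeff n (x * u ^ 2) := by
  have h : preA n =ᶠ[𝓝 x] fun x => ∫ u in (0 : ℝ)..1, kernelDeriv n 0 (x * u ^ 2) := by
    filter_upwards [Ioi_mem_nhds hx] with z hz
    have hz : 0 < z := hz
    rw [preA_eq_integral n hz, ← intervalIntegral.integral_const_mul]
    refine intervalIntegral.integral_congr fun u _ => ?_
    rw [kernelDeriv_zero n (mul_nonneg hz.le (sq_nonneg u)), mul_pow, ← pow_mul]
    ring
  rw [coeffA, h.iteratedDeriv_eq, iteratedDeriv_integral_comp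
    (fun k y hy => hasDerivAt_kernelDeriv n k hy) n hx]
  simp only [kernelDeriv_self]
  rw [div_eq_iff (by positivity), ← intervalIntegral.integral_mul_const]
  exact intervalIntegral.integral_congr fun u _ => by ring

/-! ### Power series of A_n -/

theorem hasSum_coeffA (n : ℕ) {x : ℝ} (hx : 0 < x) (hx1 : x < 1) :
    HasSum (fun j : ℕ => ((n + j).choose j : ℝ) * ((-1) ^ j * poch (1 / 2) j)
      / ((2 * ((n : ℝ) + j) + 1) * j.factorial) * x ^ j) (coeffA n x) := by
  -- Factorwise comparison with (1)_j = j!; it leaves the summable majorant `(n + j).choose j * x ^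
  -- j`, uniform in u.
  have hle : ∀ j, pochCoeff (1 / 2) j ≤ 1 := fun j => by
    refine (pochCoeff_one j).le.trans' ?_
    refine div_le_div_of_nonneg_right (c := (j.factorial : ℝ)) ?_ (by positivity)
    exact Finset.prod_le_prod (fun i _ => by positivity) fun i _ => by norm_num
  have hsum : Summable fun j : ℕ => ((n + j).choose j : ℝ) * x ^ j := by
    have := summable_choose_mul_geometric_of_norm_lt_one n (r := x)
      (by rwa [Real.norm_of_nonneg hx.le])
    refine this.congr fun j => ?_
    rw [add_comm n j, Nat.choose_symm_add]
  have h := intervalIntegral.hasSum_integral_of_dominated_convergence (μ := MeasureTheory.volume)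
    (a := 0) (b := 1)
    (F := fun (j : ℕ) u => u ^ (2 * n) *
      (((n + j).choose j : ℝ) * ((-1) ^ j * pochCoeff (1 / 2) j) * (x * u ^ 2) ^ j))
    (f := fun u => u ^ (2 * n) * kernelCoeff n (x * u ^ 2))
    (fun j _ => ((n + j).choose j : ℝ) * x ^ j)
    (fun j => Continuous.aestronglyMeasurable (by fun_prop))
    (fun j => Eventually.of_forall fun u hu => ?_)
    (Eventually.of_forall fun _ _ => hsum) intervalIntegrable_const
    (Eventually.of_forall fun u hu => ?_)
  · rw [coeffA_eq_integral n hx]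
    refine h.congr_fun fun j => ?_
    have he : ∀ u : ℝ, u ^ (2 * n) *
        (((n + j).choose j : ℝ) * ((-1) ^ j * pochCoeff (1 / 2) j) * (x * u ^ 2) ^ j)
        = ((n + j).choose j : ℝ) * ((-1) ^ j * pochCoeff (1 / 2) j) * x ^ j * u ^ (2 * (n + j)) :=
      fun u => by rw [mul_pow]; ring
    simp only [he]
    rw [intervalIntegral.integral_const_mul, integral_pow, pochCoeff]
    push_cast
    have : (2 * ((n : ℝ) + j) + 1) ≠ 0 := by positivity
    field_simp
    simp
  · rw [Set.uIoc_of_le zero_le_one] at hu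
    have h0 := pochCoeff_pos (a := 1 / 2) (by norm_num) j
    have hu2 : u ^ 2 ≤ 1 := pow_le_one₀ hu.1.le hu.2
    rw [norm_mul, norm_mul, norm_mul, norm_mul, norm_pow, norm_pow, norm_pow, norm_neg, norm_one,
      one_pow, one_mul, Real.norm_of_nonneg h0.le, Real.norm_natCast, Real.norm_of_nonneg hu.1.le,
      Real.norm_of_nonneg (mul_nonneg hx.le (sq_nonneg u))]
    have h1 : (x * u ^ 2) ^ j ≤ x ^ j := by
      refine pow_le_pow_left₀ (by positivity) ?_ j
      exact mul_le_of_le_one_right hx.le hu2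
    have h2 : u ^ (2 * n) ≤ 1 := pow_le_one₀ hu.1.le hu.2
    calc u ^ (2 * n) * (((n + j).choose j : ℝ) * pochCoeff (1 / 2) j * (x * u ^ 2) ^ j)
        ≤ 1 * (((n + j).choose j : ℝ) * 1 * x ^ j) := by
          have := hle j
          gcongr
      _ = _ := by ring
  · rw [Set.uIoc_of_le zero_le_one] at hu
    have hu2 : u ^ 2 ≤ 1 := pow_le_one₀ hu.1.le hu.2
    refine (hasSum_kernelCoeff ?_).mul_left _
    rw [abs_of_nonneg (mul_nonneg hx.le (sq_nonneg u))]
    nlinarith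

/-! ### Moment estimates -/

/-- The moments `∫_0^1 u^(2n) / √(1 + x u²) du`. -/
noncomputable def sqrtMoment (n : ℕ) (x : ℝ) : ℝ :=
  ∫ u in (0 : ℝ)..1, u ^ (2 * n) * (1 + x * u ^ 2) ^ (-(1 / 2) : ℝ)

theorem continuous_pow_mul_rpow (n : ℕ) {x : ℝ} (hx : 0 ≤ x) (a : ℝ) :
    Continuous fun u : ℝ => u ^ (2 * n) * (1 + x * u ^ 2) ^ a :=
  (continuous_pow _).mul (continuous_one_add_mul_sq_rpow hx a)

theorem continuous_pow_mul_kernelCoeff (n : ℕ) {x : ℝ} (hx : 0 ≤ x) :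
    Continuous fun u : ℝ => u ^ (2 * n) * kernelCoeff n (x * u ^ 2) :=
  (continuous_pow _).mul ((continuousOn_kernelCoeff n).comp_continuous (by fun_prop) fun u =>
    lt_of_lt_of_le (by norm_num) (mul_nonneg hx (sq_nonneg u)))

theorem coeffA_le_sqrtMoment (n : ℕ) {x : ℝ} (hx : 0 < x) : coeffA n x ≤ sqrtMoment n x := by
  rw [coeffA_eq_integral n hx]
  refine intervalIntegral.integral_mono_on zero_le_one
    ((continuous_pow_mul_kernelCoeff n hx.le).intervalIntegrable _ _)
    ((continuous_pow_mul_rpow n hx.le _).intervalIntegrable _ _) fun u hu => ?_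
  exact mul_le_mul_of_nonneg_left (kernelCoeff_le (mul_nonneg hx.le (sq_nonneg u)))
    (pow_nonneg hu.1 _)

theorem mul_sqrtMoment_le_coeffA (n : ℕ) {x : ℝ} (hx : 0 < x) :
    pochCoeff (1 / 2) n * sqrtMoment n x ≤ coeffA n x := by
  rw [coeffA_eq_integral n hx, sqrtMoment, ← intervalIntegral.integral_const_mul]
  refine intervalIntegral.integral_mono_on zero_le_one
    (((continuous_pow_mul_rpow n hx.le _).const_mul _).intervalIntegrable _ _)
    ((continuous_pow_mul_kernelCoeff n hx.le).intervalIntegrable _ _) fun u hu => ?_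
  rw [mul_left_comm]
  exact mul_le_mul_of_nonneg_left (le_kernelCoeff (mul_nonneg hx.le (sq_nonneg u)))
    (pow_nonneg hu.1 _)

/-- On [0, 1] one has u √(1 + x) ≤ √(1 + x u²), so one factor u can be traded for the square root.
-/
theorem sqrtMoment_le (n : ℕ) (hn : 1 ≤ n) {x : ℝ} (hx : 0 < x) :
    sqrtMoment n x ≤ 1 / (2 * n * Real.sqrt (1 + x)) := by
  obtain ⟨n, rfl⟩ := Nat.exists_eq_add_of_le' hn
  have h : sqrtMoment (n + 1) x ≤ ∫ u in (0 : ℝ)..1, u ^ (2 * n + 1) * (1 / Real.sqrt (1 + x)) := by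
    refine intervalIntegral.integral_mono_on zero_le_one
      ((continuous_pow_mul_rpow _ hx.le _).intervalIntegrable _ _)
      (Continuous.intervalIntegrable (by fun_prop) _ _) fun u hu => ?_
    have hp := one_add_mul_sq_pos hx.le u
    rw [rpow_neg_half _ hp.le, show 2 * (n + 1) = 2 * n + 1 + 1 by ring, pow_succ, mul_assoc]
    refine mul_le_mul_of_nonneg_left ?_ (pow_nonneg hu.1 _)
    rw [mul_one_div, div_le_div_iff₀ (Real.sqrt_pos.2 hp) (Real.sqrt_pos.2 (by linarith)), one_mul]
    refine Real.le_sqrt_of_sq_le ?_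
    rw [mul_pow, Real.sq_sqrt (by linarith)]
    nlinarith [pow_le_one₀ hu.1 hu.2 (n := 2)]
  rw [intervalIntegral.integral_mul_const, integral_pow] at h
  refine h.trans_eq ?_
  push_cast
  simp
  field_simp
  ring

theorem le_sqrtMoment (n : ℕ) {x : ℝ} (hx : 0 < x) :
    1 / ((2 * n + 1) * Real.sqrt (1 + x)) ≤ sqrtMoment n x := by
  have h : ∫ u in (0 : ℝ)..1, u ^ (2 * n) * (1 / Real.sqrt (1 + x)) ≤ sqrtMoment n x := by
    refine intervalIntegral.integral_mono_on zero_le_one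
      (Continuous.intervalIntegrable (by fun_prop) _ _)
      ((continuous_pow_mul_rpow _ hx.le _).intervalIntegrable _ _) fun u hu => ?_
    have hp := one_add_mul_sq_pos hx.le u
    rw [rpow_neg_half _ hp.le]
    refine mul_le_mul_of_nonneg_left ?_ (pow_nonneg hu.1 _)
    refine one_div_le_one_div_of_le (Real.sqrt_pos.2 hp) (Real.sqrt_le_sqrt ?_)
    nlinarith [pow_le_one₀ hu.1 hu.2 (n := 2)]
  rw [intervalIntegral.integral_mul_const, integral_pow] at h
  refine h.trans_eq' ?_
  push_cast
  simp
  field_simp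

theorem sqrtMoment_pos (n : ℕ) {x : ℝ} (hx : 0 < x) : 0 < sqrtMoment n x :=
  lt_of_lt_of_le (by positivity) (le_sqrtMoment n hx)

/-- The function (u^(2n) - u²) u (1 + x u²)^(-1/2) vanishes at 0 and 1. In its derivative, the term
(u^(2n) - u²)(1 + x u²)^(-3/2) is nonpositive on [0, 1]; dropping it leaves an integral equal to
twice the desired difference. This turns the N-th moment into the one with the closed form seen in
the lower bound. -/
theorem sqrtMoment_one_le (n : ℕ) (hn : 1 ≤ n) {x : ℝ} (hx : 0 < x) :
    sqrtMoment 1 x ≤ n * sqrtMoment n x := by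
  have h1 := continuous_pow_mul_rpow 1 hx.le (-(1 / 2))
  have h2 := continuous_pow_mul_rpow n hx.le (-(1 / 2))
  have h3 := continuous_one_add_mul_sq_rpow hx.le (-(3 / 2))
  have hd : ∀ u ∈ Set.uIcc (0 : ℝ) 1, HasDerivAt
      (fun u : ℝ => (u ^ (2 * n) - u ^ 2) * (u * (1 + x * u ^ 2) ^ (-(1 / 2) : ℝ)))
      (2 * n * (u ^ (2 * n) * (1 + x * u ^ 2) ^ (-(1 / 2) : ℝ))
        - 2 * (u ^ (2 * 1) * (1 + x * u ^ 2) ^ (-(1 / 2) : ℝ))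
        + (u ^ (2 * n) - u ^ 2) * (1 + x * u ^ 2) ^ (-(3 / 2) : ℝ)) u := by
    intro u _
    have hp := one_add_mul_sq_pos hx.le u
    have h := ((hasDerivAt_pow (2 * n) u).sub (hasDerivAt_pow 2 u)).mul ((hasDerivAt_id u).mul
      ((((hasDerivAt_pow 2 u).const_mul x).const_add 1).rpow_const (p := -(1 / 2))
        (Or.inl hp.ne')))
    convert! h using 1
    have he : (1 + x * u ^ 2) ^ (-(1 / 2) : ℝ)
        = (1 + x * u ^ 2) ^ (-(3 / 2) : ℝ) * (1 + x * u ^ 2) := by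
      rw [← Real.rpow_add_one hp.ne']; norm_num
    have hpow : u ^ (2 * n) = u ^ (2 * n - 1) * u := by
      rw [← pow_succ]; congr 1; omega
    simp only [Pi.mul_apply, Pi.sub_apply, id]
    rw [show (-(1 / 2) - 1 : ℝ) = -(3 / 2) by norm_num, he, hpow]
    generalize (1 + x * u ^ 2) ^ (-(3 / 2) : ℝ) = z
    push_cast
    ring
  have h := intervalIntegral.integral_eq_sub_of_hasDerivAt hd
    (Continuous.intervalIntegrable (by fun_prop) _ _)
  have hle : ∫ u in (0 : ℝ)..1, (2 * n * (u ^ (2 * n) * (1 + x * u ^ 2) ^ (-(1 / 2) : ℝ))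
        - 2 * (u ^ (2 * 1) * (1 + x * u ^ 2) ^ (-(1 / 2) : ℝ))
        + (u ^ (2 * n) - u ^ 2) * (1 + x * u ^ 2) ^ (-(3 / 2) : ℝ))
      ≤ ∫ u in (0 : ℝ)..1, (2 * n * (u ^ (2 * n) * (1 + x * u ^ 2) ^ (-(1 / 2) : ℝ))
        - 2 * (u ^ (2 * 1) * (1 + x * u ^ 2) ^ (-(1 / 2) : ℝ))) := by
    refine intervalIntegral.integral_mono_on zero_le_one
      (Continuous.intervalIntegrable (by fun_prop) _ _)
      (Continuous.intervalIntegrable (by fun_prop) _ _) fun u hu => ?_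
    refine add_le_of_nonpos_right (mul_nonpos_of_nonpos_of_nonneg ?_
      (Real.rpow_nonneg (one_add_mul_sq_pos hx.le u).le _))
    exact sub_nonpos.2 (pow_le_pow_of_le_one hu.1 hu.2 (by omega))
  rw [h, intervalIntegral.integral_sub (Continuous.intervalIntegrable (by fun_prop) _ _)
    (Continuous.intervalIntegrable (by fun_prop) _ _), intervalIntegral.integral_const_mul,
    intervalIntegral.integral_const_mul] at hle
  simp only [one_pow, sub_self, zero_mul, mul_zero] at hle
  change 0 ≤ 2 * n * sqrtMoment n x - 2 * sqrtMoment 1 x at hle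
  linarith

theorem sqrtMoment_one_eq {x : ℝ} (hx : 0 < x) :
    2 * x * sqrtMoment 1 x
      = Real.sqrt (1 + x) - Real.log (Real.sqrt (1 + x) + Real.sqrt x) / Real.sqrt x := by
  have h := integral_pow_mul_rpow_succ 0 hx.le
  rw [← integral_rpow_neg_half hx, ← h, sqrtMoment]
  simp

/-! ### Change of variables in the elliptic integral -/

/-- The kernel `(1 - s u²)^(-1/2) (1 - s u² + x u²)^(-1/2)`, whose expansion in powers of `s`
is integrated term by term. -/
noncomputable def ellipticKernel (s x u : ℝ) : ℝ :=
  (1 - s * u ^ 2) ^ (-(1 / 2) : ℝ) * (1 - s * u ^ 2 + x * u ^ 2) ^ (-(1 / 2) : ℝ)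

theorem mul_sq_lt_one {s u : ℝ} (hs1 : s ≤ 1) (hu : u ∈ Set.Ioo (0 : ℝ) 1) :
    s * u ^ 2 < 1 := by
  have : u ^ 2 < 1 := pow_lt_one₀ hu.1.le hu.2 two_ne_zero
  nlinarith [sq_nonneg u]

/-- Since s ≤ x the second factor is at most 1, and s u² ≤ u bounds the first by (1 - u)^(-1/2).
This covers s = 1, where the kernel can be singular at u = 1. -/
theorem integrableOn_ellipticKernel {s x : ℝ} (hs1 : s ≤ 1) (hsx : s ≤ x) :
    MeasureTheory.IntegrableOn (ellipticKernel s x) (Set.Ioo 0 1) := by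
  have h : IntervalIntegrable (fun u : ℝ => (1 - u) ^ (-(1 / 2) : ℝ)) MeasureTheory.volume 0 1 := by
    have := (intervalIntegral.intervalIntegrable_rpow' (a := 0) (b := 1) (r := -(1 / 2))
      (by norm_num)).comp_sub_left 1
    simpa using this.symm
  rw [intervalIntegrable_iff_integrableOn_Ioo_of_le zero_le_one] at h
  refine MeasureTheory.Integrable.mono' h ?_ ?_
  · refine Measurable.aestronglyMeasurable ?_
    unfold ellipticKernel
    fun_prop
  · refine (MeasureTheory.ae_restrict_iff' measurableSet_Ioo).2 (Eventually.of_forall fun u hu => ?_)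
    have hw := mul_sq_lt_one hs1 hu
    have h1 : 1 ≤ 1 - s * u ^ 2 + x * u ^ 2 := by nlinarith [sq_nonneg u]
    have h2 : 1 - u ≤ 1 - s * u ^ 2 := by nlinarith [hu.1, hu.2, sq_nonneg u]
    rw [ellipticKernel, Real.norm_of_nonneg (mul_nonneg (Real.rpow_nonneg (by linarith) _)
      (Real.rpow_nonneg (by linarith) _))]
    refine (mul_le_of_le_one_right (Real.rpow_nonneg (by linarith) _)
      (Real.rpow_le_one_of_one_le_of_nonpos h1 (by norm_num))).trans ?_
    exact Real.rpow_le_rpow_of_nonpos (by linarith [hu.2]) h2 (by norm_num)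

theorem image_sqrt_one_sub_mul_sq {lam : ℝ} (h0 : 0 ≤ lam) (h1 : lam < 1) :
    (fun u : ℝ => Real.sqrt (1 - (1 - lam ^ 2) * u ^ 2)) '' Set.Ioo 0 1 = Set.Ioo lam 1 := by
  have hs : 0 < 1 - lam ^ 2 := by nlinarith
  ext t
  constructor
  · rintro ⟨u, hu, rfl⟩
    have hu2 : u ^ 2 < 1 := pow_lt_one₀ hu.1.le hu.2 two_ne_zero
    have hu0 : 0 < u ^ 2 := pow_pos hu.1 2
    refine ⟨Real.lt_sqrt_of_sq_lt (by nlinarith), ?_⟩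
    rw [Real.sqrt_lt' one_pos]
    nlinarith
  · rintro ⟨ht0, ht1⟩
    have ht2 : t ^ 2 < 1 := pow_lt_one₀ (h0.trans ht0.le) ht1 two_ne_zero
    have hlt : lam ^ 2 < t ^ 2 := pow_lt_pow_left₀ ht0 h0 two_ne_zero
    refine ⟨Real.sqrt ((1 - t ^ 2) / (1 - lam ^ 2)), ⟨Real.sqrt_pos.2 (div_pos (by linarith) hs),
      ?_⟩, ?_⟩
    · rw [Real.sqrt_lt' one_pos, div_lt_iff₀ hs]
      linarith
    · simp only
      rw [Real.sq_sqrt (div_pos (by linarith) hs).le, mul_div_cancel₀ _ hs.ne', sub_sub_cancel,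
        Real.sqrt_sq (h0.trans ht0.le)]

theorem injOn_sqrt_one_sub_mul_sq {s : ℝ} (hs : 0 < s) (hs1 : s ≤ 1) :
    Set.InjOn (fun u : ℝ => Real.sqrt (1 - s * u ^ 2)) (Set.Ioo 0 1) := by
  intro u hu v hv h
  have h' := (Real.sqrt_inj (by linarith [mul_sq_lt_one hs1 hu])
    (by linarith [mul_sq_lt_one hs1 hv])).1 h
  have h2 : u ^ 2 = v ^ 2 := mul_left_cancel₀ hs.ne' (by linarith)
  exact (pow_left_inj₀ hu.1.le hv.1.le two_ne_zero).1 h2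

theorem hasDerivAt_sqrt_one_sub_mul_sq {s u : ℝ} (h : s * u ^ 2 < 1) :
    HasDerivAt (fun u : ℝ => Real.sqrt (1 - s * u ^ 2))
      (-(s * u) / Real.sqrt (1 - s * u ^ 2)) u := by
  have h' := (((hasDerivAt_pow 2 u).const_mul s).const_sub 1).sqrt (by linarith : 1 - s * u ^ 2 ≠ 0)
  convert! h' using 1
  simp
  ring

theorem abs_deriv_smul_integrand {s k u : ℝ} (hs : 0 < s) (hs1 : s ≤ 1) (hk0 : 0 < k) (hk1 : k < 1)
    (hu : u ∈ Set.Ioo (0 : ℝ) 1) :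
    |-(s * u) / Real.sqrt (1 - s * u ^ 2)| •
      (1 / Real.sqrt ((1 - Real.sqrt (1 - s * u ^ 2) ^ 2) *
        (1 - k ^ 2 * Real.sqrt (1 - s * u ^ 2) ^ 2)))
      = Real.sqrt s / Real.sqrt (1 - k ^ 2) * ellipticKernel s (s / (1 - k ^ 2)) u := by
  have hm : 0 < 1 - k ^ 2 := by nlinarith
  have hw := mul_sq_lt_one hs1 hu
  have hw' : 0 < 1 - s * u ^ 2 := by linarith
  have hz : 0 < 1 - s * u ^ 2 + s / (1 - k ^ 2) * u ^ 2 := by positivity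
  rw [ellipticKernel, rpow_neg_half _ hw'.le, rpow_neg_half _ hz.le, Real.sq_sqrt hw'.le,
    show (1 - (1 - s * u ^ 2)) * (1 - k ^ 2 * (1 - s * u ^ 2))
      = s * u ^ 2 * ((1 - k ^ 2) * (1 - s * u ^ 2 + s / (1 - k ^ 2) * u ^ 2)) by field_simp; ring,
    Real.sqrt_mul (by positivity), Real.sqrt_mul hs.le, Real.sqrt_mul hm.le, Real.sqrt_sq hu.1.le,
    neg_div, abs_neg, abs_of_nonneg (by have := hu.1; positivity), smul_eq_mul]
  have h1 := Real.sqrt_pos.2 hw'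
  have h2 := Real.sqrt_pos.2 hz
  have h3 := Real.sqrt_pos.2 hm
  have h4 := Real.sqrt_pos.2 hs
  have h5 := Real.sq_sqrt hs.le
  have h6 := hu.1
  generalize Real.sqrt (1 - s * u ^ 2) = a at *
  generalize Real.sqrt (1 - s * u ^ 2 + s / (1 - k ^ 2) * u ^ 2) = b at *
  generalize Real.sqrt (1 - k ^ 2) = c at *
  field_simp
  linarith

theorem integrableOn_integrand {lam k : ℝ} (h0 : 0 ≤ lam) (h1 : lam < 1) (hk0 : 0 < k) (hk1 : k < 1) :
    MeasureTheory.IntegrableOn (fun t : ℝ => 1 / Real.sqrt ((1 - t ^ 2) * (1 - k ^ 2 * t ^ 2)))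
      (Set.Ioo lam 1) := by
  have hs : 0 < 1 - lam ^ 2 := by nlinarith
  have hs1 : 1 - lam ^ 2 ≤ 1 := by nlinarith
  have hm : 0 < 1 - k ^ 2 := by nlinarith
  rw [← image_sqrt_one_sub_mul_sq h0 h1,
    MeasureTheory.integrableOn_image_iff_integrableOn_abs_deriv_smul measurableSet_Ioo
      (fun u hu => (hasDerivAt_sqrt_one_sub_mul_sq (mul_sq_lt_one hs1 hu)).hasDerivWithinAt)
      (injOn_sqrt_one_sub_mul_sq hs hs1),
    MeasureTheory.integrableOn_congr_fun
      (fun u hu => abs_deriv_smul_integrand hs hs1 hk0 hk1 hu) measurableSet_Ioo]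
  refine (integrableOn_ellipticKernel hs1 ?_).const_mul _
  rw [le_div_iff₀ hm]
  nlinarith [sq_nonneg k]

theorem ellipticK_sub_ellipticF {lam k : ℝ} (h0 : 0 ≤ lam) (h1 : lam < 1) (hk0 : 0 < k)
    (hk1 : k < 1) :
    ellipticK k - ellipticF lam k = Real.sqrt (1 - lam ^ 2) / Real.sqrt (1 - k ^ 2) *
      ∫ u in (0 : ℝ)..1, ellipticKernel (1 - lam ^ 2) ((1 - lam ^ 2) / (1 - k ^ 2)) u := by
  have hs : 0 < 1 - lam ^ 2 := by nlinarith
  have hs1 : 1 - lam ^ 2 ≤ 1 := by nlinarith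
  have hi : IntervalIntegrable
      (fun t : ℝ => 1 / Real.sqrt ((1 - t ^ 2) * (1 - k ^ 2 * t ^ 2))) MeasureTheory.volume 0 1 :=
    (intervalIntegrable_iff_integrableOn_Ioo_of_le zero_le_one).2
      (integrableOn_integrand le_rfl one_pos hk0 hk1)
  have hi2 := hi.mono_set (c := 0) (d := lam) (by
    rw [Set.uIcc_of_le h0, Set.uIcc_of_le zero_le_one]; exact Set.Icc_subset_Icc_right h1.le)
  rw [ellipticK, ellipticF, ellipticF, intervalIntegral.integral_interval_sub_left hi hi2,
    intervalIntegral.integral_of_le h1.le, MeasureTheory.integral_Ioc_eq_integral_Ioo,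
    ← image_sqrt_one_sub_mul_sq h0 h1,
    MeasureTheory.integral_image_eq_integral_abs_deriv_smul measurableSet_Ioo
      (fun u hu => (hasDerivAt_sqrt_one_sub_mul_sq (mul_sq_lt_one hs1 hu)).hasDerivWithinAt)
      (injOn_sqrt_one_sub_mul_sq hs hs1),
    MeasureTheory.setIntegral_congr_fun measurableSet_Ioo
      (fun u hu => abs_deriv_smul_integrand hs hs1 hk0 hk1 hu),
    MeasureTheory.integral_const_mul, intervalIntegral.integral_of_le zero_le_one,
    MeasureTheory.integral_Ioc_eq_integral_Ioo]

/-! ### Termwise integration and the tail of the series -/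

theorem mul_pow_mul_kernelCoeff (n : ℕ) (s x u : ℝ) :
    kernelCoeff n (x * u ^ 2) * (s * u ^ 2) ^ n
      = s ^ n * (u ^ (2 * n) * kernelCoeff n (x * u ^ 2)) := by
  rw [mul_pow, ← pow_mul]; ring

theorem integral_pow_mul_kernelCoeff (n : ℕ) {x : ℝ} (hx : 0 < x) (s : ℝ) :
    ∫ u in (0 : ℝ)..1, kernelCoeff n (x * u ^ 2) * (s * u ^ 2) ^ n = s ^ n * coeffA n x := by
  simp only [mul_pow_mul_kernelCoeff]
  rw [intervalIntegral.integral_const_mul, coeffA_eq_integral n hx]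

theorem intervalIntegrable_pow_mul_kernelCoeff (n : ℕ) {x : ℝ} (hx : 0 < x) (s : ℝ) :
    IntervalIntegrable (fun u => kernelCoeff n (x * u ^ 2) * (s * u ^ 2) ^ n)
      MeasureTheory.volume 0 1 := by
  simp only [mul_pow_mul_kernelCoeff]
  exact ((continuous_pow_mul_kernelCoeff n hx.le).const_mul _).intervalIntegrable _ _

theorem intervalIntegrable_sum_kernelCoeff (N : ℕ) {x : ℝ} (hx : 0 < x) (s : ℝ) :
    IntervalIntegrable
      (fun u => ∑ n ∈ Finset.range N, kernelCoeff n (x * u ^ 2) * (s * u ^ 2) ^ n)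
      MeasureTheory.volume 0 1 := by
  simpa only [Finset.sum_fn] using IntervalIntegrable.sum (Finset.range N) fun n _ =>
    intervalIntegrable_pow_mul_kernelCoeff n hx s

theorem intervalIntegrable_ellipticKernel {s x : ℝ} (hs1 : s ≤ 1) (hsx : s ≤ x) :
    IntervalIntegrable (ellipticKernel s x) MeasureTheory.volume 0 1 :=
  (intervalIntegrable_iff_integrableOn_Ioo_of_le zero_le_one).2
    (integrableOn_ellipticKernel hs1 hsx)

theorem hasSum_ellipticKernel {s x u : ℝ} (hs : 0 < s) (hs1 : s ≤ 1) (hx : 0 < x)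
    (hu : u ∈ Set.Ioo (0 : ℝ) 1) :
    HasSum (fun n => kernelCoeff n (x * u ^ 2) * (s * u ^ 2) ^ n) (ellipticKernel s x u) :=
  hasSum_kernelCoeff_mul_pow (by positivity) (mul_sq_lt_one hs1 hu) (by positivity)

/-- A series of nonnegative terms dominates its partial sum through index N; no interchange of an
infinite sum with the integral is needed. -/
theorem le_integral_ellipticKernel_sub (N : ℕ) {s x : ℝ} (hs : 0 < s) (hs1 : s ≤ 1)
    (hsx : s ≤ x) :
    s ^ N * coeffA N x ≤ (∫ u in (0 : ℝ)..1, ellipticKernel s x u)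
      - ∑ n ∈ Finset.range N, s ^ n * coeffA n x := by
  have hx := hs.trans_le hsx
  rw [le_sub_iff_add_le', ← Finset.sum_range_succ]
  simp only [← integral_pow_mul_kernelCoeff _ hx s]
  rw [← intervalIntegral.integral_finsetSum fun n _ =>
    intervalIntegrable_pow_mul_kernelCoeff n hx s]
  refine intervalIntegral.integral_mono_on_of_le_Ioo zero_le_one
    (intervalIntegrable_sum_kernelCoeff _ hx s)
    (intervalIntegrable_ellipticKernel hs1 hsx) fun u hu => ?_
  refine sum_le_hasSum _ (fun n _ => ?_) (hasSum_ellipticKernel hs hs1 hx hu)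
  exact mul_nonneg (kernelCoeff_pos (by positivity)).le (by positivity)

theorem integral_ellipticKernel_sub_le (N : ℕ) {s x : ℝ} (hs : 0 < s) (hs1 : s < 1)
    (hsx : s ≤ x) :
    (∫ u in (0 : ℝ)..1, ellipticKernel s x u) - ∑ n ∈ Finset.range N, s ^ n * coeffA n x
      ≤ s ^ N / (1 - s) * sqrtMoment N x := by
  have hx := hs.trans_le hsx
  have hs1' : 0 < 1 - s := by linarith
  simp only [← integral_pow_mul_kernelCoeff _ hx s]
  rw [← intervalIntegral.integral_finsetSum fun n _ =>
    intervalIntegrable_pow_mul_kernelCoeff n hx s, ← intervalIntegral.integral_sub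
    (intervalIntegrable_ellipticKernel hs1.le hsx)
    (intervalIntegrable_sum_kernelCoeff _ hx s),
    sqrtMoment, ← intervalIntegral.integral_const_mul]
  refine intervalIntegral.integral_mono_on_of_le_Ioo zero_le_one
    ((intervalIntegrable_ellipticKernel hs1.le hsx).sub
      (intervalIntegrable_sum_kernelCoeff _ hx s))
    (((continuous_pow_mul_rpow N hx.le _).const_mul _).intervalIntegrable _ _) fun u hu => ?_
  have hw := mul_sq_lt_one hs1.le hu
  have hw0 : 0 ≤ s * u ^ 2 := by positivity
  have hy : 0 ≤ x * u ^ 2 := by positivity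
  have htail := (hasSum_nat_add_iff' N).2 (hasSum_ellipticKernel hs hs1.le hx hu)
  -- Bounding every coefficient of the tail by (1 + y)^(-1/2) leaves a geometric series in w = s u²,
  -- with sum w^N / (1 - w); then 1 - w ≥ 1 - s.
  have hgeom := ((hasSum_geometric_of_lt_one hw0 hw).mul_left ((s * u ^ 2) ^ N)).mul_left
    ((1 + x * u ^ 2) ^ (-(1 / 2) : ℝ))
  refine (hasSum_le (fun n => ?_) htail hgeom).trans ?_
  · rw [add_comm n N, pow_add]
    exact mul_le_mul_of_nonneg_right (kernelCoeff_le hy) (by positivity)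
  · have hsu : s * u ^ 2 ≤ s := mul_le_of_le_one_right hs.le (pow_le_one₀ hu.1.le hu.2.le)
    have h1 : (1 - s * u ^ 2)⁻¹ ≤ (1 - s)⁻¹ := inv_anti₀ hs1' (by linarith)
    have h2 : 0 ≤ (1 + x * u ^ 2) ^ (-(1 / 2) : ℝ) := by positivity
    calc _ ≤ (1 + x * u ^ 2) ^ (-(1 / 2) : ℝ) * ((s * u ^ 2) ^ N * (1 - s)⁻¹) := by gcongr
      _ = _ := by rw [mul_pow, ← pow_mul]; ring

theorem coeffA_pos (n : ℕ) {x : ℝ} (hx : 0 < x) : 0 < coeffA n x :=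
  (mul_pos (pochCoeff_pos (by norm_num) n) (sqrtMoment_pos n hx)).trans_le
    (mul_sqrtMoment_le_coeffA n hx)

/-! ### Matching the explicit bounds -/

theorem lowerBound_eq (N : ℕ) {lam k : ℝ} (h0 : 0 ≤ lam) (h1 : lam < 1) (hk0 : 0 < k)
    (hk1 : k < 1) :
    lowerBound N lam k = Real.sqrt (1 - lam ^ 2) / Real.sqrt (1 - k ^ 2) *
      ((1 - lam ^ 2) ^ N * (pochCoeff (1 / 2) N / N *
        sqrtMoment 1 ((1 - lam ^ 2) / (1 - k ^ 2)))) := by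
  have hs : 0 < 1 - lam ^ 2 := by nlinarith
  have hm : 0 < 1 - k ^ 2 := by nlinarith
  have hx : 0 < (1 - lam ^ 2) / (1 - k ^ 2) := by positivity
  have hJ := sqrtMoment_one_eq hx
  rw [lowerBound, show 2 - lam ^ 2 - k ^ 2 = (1 - k ^ 2) * (1 + (1 - lam ^ 2) / (1 - k ^ 2)) by
    field_simp; ring]
  set s := 1 - lam ^ 2 with hsdef
  set m := 1 - k ^ 2 with hmdef
  set x := s / m with hxdef
  have hsx : s = m * x := by rw [hxdef]; field_simp
  have hx1 : 0 < 1 + x := by linarith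
  have hpow : s ^ ((N : ℝ) - 1 / 2) = s ^ N / Real.sqrt s := by
    rw [Real.rpow_sub hs, Real.rpow_natCast, ← Real.sqrt_eq_rpow]
  have hroot : Real.sqrt (s * (m * (1 + x))) / m = Real.sqrt (1 + x) * Real.sqrt x := by
    rw [hsx, show m * x * (m * (1 + x)) = m ^ 2 * ((1 + x) * x) by ring,
      Real.sqrt_mul (sq_nonneg m), Real.sqrt_sq hm.le, Real.sqrt_mul hx1.le]
    field_simp
  -- The argument is the perfect square (√(1 + x) + √x)².
  have hlog : Real.log (1 + 2 * x + 2 * (Real.sqrt (1 + x) * Real.sqrt x))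
      = 2 * Real.log (Real.sqrt (1 + x) + Real.sqrt x) := by
    rw [← Real.log_rpow (by positivity)]
    norm_num [add_sq, Real.sq_sqrt hx.le, Real.sq_sqrt hx1.le]
    congr 1
    ring
  rw [hroot, hlog, hpow, Real.sqrt_mul hm.le, pochCoeff]
  have hsm : Real.sqrt s = Real.sqrt m * Real.sqrt x := by rw [hsx, Real.sqrt_mul hm.le]
  have hm2 := Real.sq_sqrt hm.le
  have hx2 := Real.sq_sqrt hx.le
  have hm0 := Real.sqrt_pos.2 hm
  have hx0 := Real.sqrt_pos.2 hx
  have hJ' : Real.sqrt m * Real.sqrt (1 + x) - m / (2 * Real.sqrt s) *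
      (2 * Real.log (Real.sqrt (1 + x) + Real.sqrt x)) = Real.sqrt m * (2 * x * sqrtMoment 1 x) := by
    rw [hJ, hsm]
    generalize Real.sqrt (1 + x) = r at *
    field_simp
    rw [hm2]
    ring
  rw [hJ', hsm]
  generalize sqrtMoment 1 x = J at *
  field_simp
  rw [hx2]
  ring

theorem upperBound_eq (N : ℕ) {lam k : ℝ} (h0 : 0 < lam) (h1 : lam < 1) (hk0 : 0 < k)
    (hk1 : k < 1) :
    upperBound N lam k = Real.sqrt (1 - lam ^ 2) / Real.sqrt (1 - k ^ 2) *
      ((1 - lam ^ 2) ^ N / lam ^ 2 *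
        (1 / (2 * N * Real.sqrt (1 + (1 - lam ^ 2) / (1 - k ^ 2))))) := by
  have hs : 0 < 1 - lam ^ 2 := by nlinarith
  have hm : 0 < 1 - k ^ 2 := by nlinarith
  rw [upperBound, show 2 - lam ^ 2 - k ^ 2 = (1 - k ^ 2) * (1 + (1 - lam ^ 2) / (1 - k ^ 2)) by
    field_simp; ring, Real.rpow_add hs, Real.rpow_natCast, ← Real.sqrt_eq_rpow,
    Real.sqrt_mul hm.le]
  field_simp

/-- The remainder after `N` terms of the expansion. -/
noncomputable def remainder (N : ℕ) (lam k : ℝ) : ℝ :=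
  ellipticF lam k - ellipticK k + Real.sqrt (1 - lam ^ 2) / Real.sqrt (1 - k ^ 2)
    * ∑ n ∈ Finset.range N, (1 - lam ^ 2) ^ n * coeffA n ((1 - lam ^ 2) / (1 - k ^ 2))

theorem neg_remainder_eq (N : ℕ) {lam k : ℝ} (h0 : 0 ≤ lam) (h1 : lam < 1) (hk0 : 0 < k)
    (hk1 : k < 1) :
    -remainder N lam k = Real.sqrt (1 - lam ^ 2) / Real.sqrt (1 - k ^ 2) *
      ((∫ u in (0 : ℝ)..1, ellipticKernel (1 - lam ^ 2) ((1 - lam ^ 2) / (1 - k ^ 2)) u)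
        - ∑ n ∈ Finset.range N, (1 - lam ^ 2) ^ n * coeffA n ((1 - lam ^ 2) / (1 - k ^ 2))) := by
  rw [mul_sub, ← ellipticK_sub_ellipticF h0 h1 hk0 hk1, remainder]
  ring

theorem expansionTerm_le_neg_remainder (N : ℕ) {lam k : ℝ} (h0 : 0 ≤ lam) (h1 : lam < 1)
    (hk0 : 0 < k) (hk1 : k < 1) : expansionTerm N lam k ≤ -remainder N lam k := by
  have hs : 0 < 1 - lam ^ 2 := by nlinarith
  have hm : 0 < 1 - k ^ 2 := by nlinarith
  rw [neg_remainder_eq N h0 h1 hk0 hk1, expansionTerm]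
  refine mul_le_mul_of_nonneg_left (le_integral_ellipticKernel_sub N hs (by nlinarith) ?_)
    (by positivity)
  rw [le_div_iff₀ hm]
  nlinarith [sq_nonneg k]

theorem expansionTerm_pos (n : ℕ) {lam k : ℝ} (h0 : 0 ≤ lam) (h1 : lam < 1)
    (hk0 : 0 < k) (hk1 : k < 1) : 0 < expansionTerm n lam k := by
  have hs : 0 < 1 - lam ^ 2 := by nlinarith
  have hm : 0 < 1 - k ^ 2 := by nlinarith
  have := coeffA_pos n (div_pos hs hm)
  unfold expansionTerm
  positivity

theorem lowerBound_le_expansionTerm (N : ℕ) (hN : 1 ≤ N) {lam k : ℝ} (h0 : 0 ≤ lam)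
    (h1 : lam < 1) (hk0 : 0 < k) (hk1 : k < 1) : lowerBound N lam k ≤ expansionTerm N lam k := by
  have hs : 0 < 1 - lam ^ 2 := by nlinarith
  have hm : 0 < 1 - k ^ 2 := by nlinarith
  have hx := div_pos hs hm
  have hN0 : (0 : ℝ) < N := by exact_mod_cast hN
  rw [lowerBound_eq N h0 h1 hk0 hk1, expansionTerm]
  refine mul_le_mul_of_nonneg_left (mul_le_mul_of_nonneg_left ?_ (by positivity)) (by positivity)
  refine le_trans ?_ (mul_sqrtMoment_le_coeffA N hx)
  rw [div_mul_eq_mul_div, div_le_iff₀ hN0, mul_assoc]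
  refine mul_le_mul_of_nonneg_left ?_ (pochCoeff_pos (by norm_num) N).le
  rw [mul_comm]
  exact sqrtMoment_one_le N hN hx

theorem neg_remainder_le_upperBound (N : ℕ) (hN : 1 ≤ N) {lam k : ℝ} (h0 : 0 < lam)
    (h1 : lam < 1) (hk0 : 0 < k) (hk1 : k < 1) : -remainder N lam k ≤ upperBound N lam k := by
  have hs : 0 < 1 - lam ^ 2 := by nlinarith
  have hm : 0 < 1 - k ^ 2 := by nlinarith
  have hx := div_pos hs hm
  rw [neg_remainder_eq N h0.le h1 hk0 hk1, upperBound_eq N h0 h1 hk0 hk1]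
  refine mul_le_mul_of_nonneg_left ?_ (by positivity)
  refine (integral_ellipticKernel_sub_le N hs (by nlinarith) ?_).trans ?_
  · rw [le_div_iff₀ hm]
    nlinarith [sq_nonneg k]
  · rw [sub_sub_cancel]
    exact mul_le_mul_of_nonneg_left (sqrtMoment_le N hN hx) (by positivity)

/-! ### Asymptotics along curves -/

/-- The shape shared by the bounds of a term of the expansion and of its remainder. -/
noncomputable def termScale (n : ℕ) (lam k : ℝ) : ℝ :=
  Real.sqrt (1 - lam ^ 2) / Real.sqrt (1 - k ^ 2) *
    ((1 - lam ^ 2) ^ n / Real.sqrt (1 + (1 - lam ^ 2) / (1 - k ^ 2)))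

theorem termScale_nonneg (n : ℕ) {lam k : ℝ} (h0 : 0 ≤ lam) (h1 : lam < 1) :
    0 ≤ termScale n lam k := by
  have hs : 0 < 1 - lam ^ 2 := by nlinarith
  unfold termScale
  positivity

theorem termScale_succ (n : ℕ) (lam k : ℝ) :
    termScale (n + 1) lam k = (1 - lam ^ 2) * termScale n lam k := by
  unfold termScale; ring

theorem le_expansionTerm (n : ℕ) {lam k : ℝ} (h0 : 0 ≤ lam) (h1 : lam < 1)
    (hk0 : 0 < k) (hk1 : k < 1) :
    pochCoeff (1 / 2) n / (2 * n + 1) * termScale n lam k ≤ expansionTerm n lam k := by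
  have hs : 0 < 1 - lam ^ 2 := by nlinarith
  have hm : 0 < 1 - k ^ 2 := by nlinarith
  have hx := div_pos hs hm
  have h := (mul_le_mul_of_nonneg_left (le_sqrtMoment n hx)
    (pochCoeff_pos (a := 1 / 2) (by norm_num) n).le).trans (mul_sqrtMoment_le_coeffA n hx)
  rw [expansionTerm]
  refine le_trans (le_of_eq ?_) (mul_le_mul_of_nonneg_left
    (mul_le_mul_of_nonneg_left h (pow_nonneg hs.le n)) (by positivity))
  rw [termScale]
  field_simp

/-- Order 0 is excluded: A_0 carries a logarithm as x → ∞ and is not bounded by this scale. Only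
orders n + 1 need an upper estimate in the asymptotic statement. -/
theorem expansionTerm_le (n : ℕ) (hn : 1 ≤ n) {lam k : ℝ} (h0 : 0 ≤ lam) (h1 : lam < 1)
    (hk0 : 0 < k) (hk1 : k < 1) : expansionTerm n lam k ≤ termScale n lam k := by
  have hs : 0 < 1 - lam ^ 2 := by nlinarith
  have hm : 0 < 1 - k ^ 2 := by nlinarith
  have hx := div_pos hs hm
  have hn' : (1 : ℝ) ≤ n := by exact_mod_cast hn
  have h := (coeffA_le_sqrtMoment n hx).trans (sqrtMoment_le n hn hx)
  rw [expansionTerm, termScale]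
  refine mul_le_mul_of_nonneg_left ?_ (by positivity)
  rw [div_eq_mul_one_div ((1 - lam ^ 2) ^ n)]
  refine mul_le_mul_of_nonneg_left (h.trans ?_) (by positivity)
  refine one_div_le_one_div_of_le (by positivity) ?_
  exact le_mul_of_one_le_left (by positivity) (by linarith)

theorem upperBound_le (N : ℕ) (hN : 1 ≤ N) {lam k : ℝ} (h0 : 1 / 2 < lam) (h1 : lam < 1)
    (hk0 : 0 < k) (hk1 : k < 1) : upperBound N lam k ≤ 2 * termScale N lam k := by
  have hs : 0 < 1 - lam ^ 2 := by nlinarith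
  have hm : 0 < 1 - k ^ 2 := by nlinarith
  have hN' : (1 : ℝ) ≤ N := by exact_mod_cast hN
  have hlam : 1 / 4 ≤ lam ^ 2 := by nlinarith
  -- From lam² ≥ 1/4 and N ≥ 1.
  have h2 : 1 / (lam ^ 2 * (2 * N)) ≤ 2 := by
    rw [div_le_iff₀ (by positivity)]
    nlinarith
  have h3 := mul_le_mul_of_nonneg_right h2 (termScale_nonneg (k := k) N (by linarith) h1)
  refine le_trans (le_of_eq ?_) h3
  rw [upperBound_eq N (by linarith) h1 hk0 hk1, termScale]
  field_simp

/-- The n-th term is bounded below by a positive multiple of `termScale n`, uniformly in k, while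
`termScale (n + 1)` is smaller by the factor 1 - lam² → 0; hence no hypothesis on the limit of k is
needed. -/
theorem isLittleO_of_le_mul_termScale {l : Filter ℝ} {lam k : ℝ → ℝ} {f : ℝ → ℝ} {C : ℝ} (n : ℕ)
    (hmem : ∀ᶠ s in l, 0 < lam s ∧ lam s < 1 ∧ 0 < k s ∧ k s < 1) (hlim : Tendsto lam l (𝓝 1))
    (hf : ∀ᶠ s in l, |f s| ≤ C * termScale (n + 1) (lam s) (k s)) :
    f =o[l] fun s => expansionTerm n (lam s) (k s) := by
  have hsmall : (fun s => 1 - lam s ^ 2) =o[l] fun _ => (1 : ℝ) := by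
    rw [isLittleO_one_iff]
    simpa using (hlim.pow 2).const_sub 1
  have hbig : (fun s => termScale n (lam s) (k s)) =O[l]
      fun s => expansionTerm n (lam s) (k s) := by
    have hc : 0 < pochCoeff (1 / 2) n / (2 * n + 1) :=
      div_pos (pochCoeff_pos (by norm_num) n) (by positivity)
    refine IsBigO.of_bound (pochCoeff (1 / 2) n / (2 * n + 1))⁻¹ ?_
    filter_upwards [hmem] with s hs
    rw [Real.norm_of_nonneg (termScale_nonneg n hs.1.le hs.2.1), Real.norm_of_nonneg
      (expansionTerm_pos n hs.1.le hs.2.1 hs.2.2.1 hs.2.2.2).le, le_inv_mul_iff₀ hc]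
    exact le_expansionTerm n hs.1.le hs.2.1 hs.2.2.1 hs.2.2.2
  have hf' : f =O[l] fun s => termScale (n + 1) (lam s) (k s) := by
    refine IsBigO.of_bound C ?_
    filter_upwards [hf, hmem] with s hs hs'
    rwa [Real.norm_of_nonneg (termScale_nonneg _ hs'.1.le hs'.2.1)]
  refine hf'.trans_isLittleO ?_
  simp only [termScale_succ]
  simpa using hsmall.mul_isBigO hbig

theorem mainTheorem2 :
    -- each `A_n` is the sum of its defining power series on the interval of convergence
    (∀ (n : ℕ) (x : ℝ), 0 < x → x < 1 →
      HasSum (fun j : ℕ => ((n + j).choose j : ℝ) * ((-1) ^ j * poch (1 / 2) j)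
        / ((2 * ((n : ℝ) + j) + 1) * j.factorial) * x ^ j) (coeffA n x)) ∧
    ∃ R : ℕ → ℝ → ℝ → ℝ,
      -- the expansion and the two-sided bounds of its remainder
      (∀ (N : ℕ) (lam k : ℝ), 1 ≤ N → 0 ≤ lam → lam ≤ 1 → 0 < k → k < 1 →
        ellipticF lam k
            = ellipticK k
              - Real.sqrt (1 - lam ^ 2) / Real.sqrt (1 - k ^ 2)
                * ∑ n ∈ Finset.range N,
                    (1 - lam ^ 2) ^ n * coeffA n ((1 - lam ^ 2) / (1 - k ^ 2))
              + R N lam k ∧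
          (lam = 1 → R N lam k = 0) ∧
          (lam < 1 → R N lam k < 0 ∧ lowerBound N lam k ≤ -R N lam k) ∧
          (0 < lam → lam < 1 → -R N lam k ≤ upperBound N lam k)) ∧
      -- the expansion is asymptotic as `lam → 1` along any curve inside the open unit square
      (∀ (l : Filter ℝ) (lam k : ℝ → ℝ),
        (∀ᶠ s in l, 0 < lam s ∧ lam s < 1 ∧ 0 < k s ∧ k s < 1) →
        Tendsto lam l (𝓝 1) →
        (∀ n : ℕ, (fun s => expansionTerm (n + 1) (lam s) (k s))
            =o[l] fun s => expansionTerm n (lam s) (k s)) ∧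
        (∀ N : ℕ, 1 ≤ N → (fun s => R N (lam s) (k s))
            =o[l] fun s => expansionTerm (N - 1) (lam s) (k s))) := by
  refine ⟨fun n x hx hx1 => hasSum_coeffA n hx hx1, remainder, ?_, ?_⟩
  · intro N lam k hN h0 h1 hk0 hk1
    refine ⟨by rw [remainder]; ring, ?_, fun hlt => ?_, fun h0' hlt =>
      neg_remainder_le_upperBound N hN h0' hlt hk0 hk1⟩
    · rintro rfl
      simp [remainder, ellipticK]
    · have h := expansionTerm_le_neg_remainder N h0 hlt hk0 hk1
      exact ⟨neg_pos.1 ((expansionTerm_pos N h0 hlt hk0 hk1).trans_le h),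
        (lowerBound_le_expansionTerm N hN h0 hlt hk0 hk1).trans h⟩
  · intro l lam k hmem hlim
    constructor
    · intro n
      refine isLittleO_of_le_mul_termScale (C := 1) n hmem hlim ?_
      filter_upwards [hmem] with s hs
      rw [abs_of_pos (expansionTerm_pos _ hs.1.le hs.2.1 hs.2.2.1 hs.2.2.2), one_mul]
      exact expansionTerm_le _ (by omega) hs.1.le hs.2.1 hs.2.2.1 hs.2.2.2
    · intro N hN
      obtain ⟨n, rfl⟩ := Nat.exists_eq_add_of_le' hN
      refine isLittleO_of_le_mul_termScale (C := 2) n hmem hlim ?_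
      filter_upwards [hmem, hlim.eventually_const_lt (u := 1 / 2) (by norm_num)] with s hs hs2
      have h := (expansionTerm_pos (n + 1) hs.1.le hs.2.1 hs.2.2.1 hs.2.2.2).trans_le
        (expansionTerm_le_neg_remainder (n + 1) hs.1.le hs.2.1 hs.2.2.1 hs.2.2.2)
      rw [← abs_neg, abs_of_pos h]
      exact (neg_remainder_le_upperBound (n + 1) hN hs.1 hs.2.1 hs.2.2.1 hs.2.2.2).trans
        (upperBound_le (n + 1) hN hs2 hs.2.1 hs.2.2.1 hs.2.2.2)
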